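/- Let $0<B_L\le B_U$, $0\le M<\infty$, let $\mu$ be a probability law on $\mathbb R$ with $\mu([B_L,B_U])=1$, and let $g:[0,\infty)\to[0,\infty)$ be continuous and nondecreasing. Let $Y_0,Y_1,\dots$ be i.i.d. transmission delays with law $\mu$ on a probability space. Given waiting periods $Z_0,Z_1,\dots\in[0,M]$, Update $0$ is generated at $R_0=-Y_0$ and delivered at $D_0=0$, and for $j\ge 0$ Update $j+1$ is requested (and generated) at $R_{j+1}=D_j+Z_j$ and delivered at $D_{j+1}=R_{j+1}+Y_{j+1}$. The age of information at time $t\ge 0$ is $\Delta(t)=t-\max\{R_j: D_j\le t\}$; in particular $\Delta(D_j)=Y_j$ almost surely. A causal policy is a sequence $Z=(Z_j)_{j\ge0}$ of $[0,M]$-valued random variables, possibly history-dependent and randomized, for which there is a filtration $(\mathcal F_j)_{j\ge 0}$ such that $Y_j$ and $Z_j$ are $\mathcal F_j$-measurable and $Y_{j+1}$ is independent of $\mathcal F_j$, for every $j\ge 0$. For a query time $Q>0$, the single-query problem is to minimize $E[g(\Delta(Q))]$ over all causal policies. Then there is a Borel function $z:\mathbb R^2\to[0,M]$, depending only on $\mu$,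 $M$ and $g$, such that for every probability space carrying such a delay process and every $Q>0$ the deterministic policy defined recursively by $$Z_j = z(Y_j,\,Q-D_j)=z(\Delta(D_j),\,Q-D_j)\quad(\text{second equality almost surely}),\qquad j=0,1,2,\dots,$$ is causal and optimal for the single-query problem: $g(\Delta(Q))$ is integrable under every causal policy, and $E[g(\Delta(Q))]$ under this policy is at most its value under any causal policy. -/

import Mathlib

open MeasureTheory ProbabilityTheory Set

namespace PullOrWait

/-- Delivery times `D_j` along a sequence of delays `Y` and waiting periods `Z`: Update `0` is
delivered at time `0`, and `D_{j+1} = D_j + Z_j + Y_{j+1}`. -/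
noncomputable def deliveryTime (Y Z : ℕ → ℝ) : ℕ → ℝ
  | 0 => 0
  | j + 1 => deliveryTime Y Z j + Z j + Y (j + 1)

/-- Request (= generation) times `R_j`: `R_{j+1} = D_j + Z_j`, and `R_0 = -Y_0`, so that the age at
time `D_0 = 0` is `Y_0`. -/
noncomputable def requestTime (Y Z : ℕ → ℝ) : ℕ → ℝ
  | 0 => -Y 0
  | j + 1 => deliveryTime Y Z j + Z j

/-- `U(t) = max {R_j : D_j ≤ t}`, the generation time of the freshest update received by time `t`. -/
noncomputable def lastGeneration (Y Z : ℕ → ℝ) (t : ℝ) : ℝ :=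
  sSup {r | ∃ j, deliveryTime Y Z j ≤ t ∧ r = requestTime Y Z j}

/-- Age of information `Δ(t) = t - U(t)`. -/
noncomputable def age (Y Z : ℕ → ℝ) (t : ℝ) : ℝ :=
  t - lastGeneration Y Z t

theorem deliveryTime_eq (Y Z : ℕ → ℝ) (j : ℕ) :
    deliveryTime Y Z j = requestTime Y Z j + Y j := by
  cases j <;> simp [deliveryTime, requestTime]

/-- The age at the delivery point `D_j` is `Y_j`. -/
theorem age_deliveryTime {Y Z : ℕ → ℝ} (hY : ∀ j, 0 < Y j) (hZ : ∀ j, 0 ≤ Z j) (j : ℕ) :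
    age Y Z (deliveryTime Y Z j) = Y j := by
  have hD : StrictMono (deliveryTime Y Z) := strictMono_nat_of_lt_succ fun i => by
    have := hY (i + 1)
    have := hZ i
    simp only [deliveryTime]
    linarith
  have hR : Monotone (requestTime Y Z) := monotone_nat_of_le_succ fun i => by
    have := hY i
    have := hZ i
    have := deliveryTime_eq Y Z i
    have : requestTime Y Z (i + 1) = deliveryTime Y Z i + Z i := rfl
    linarith
  have hU : IsGreatest {r | ∃ i, deliveryTime Y Z i ≤ deliveryTime Y Z j ∧
      r = requestTime Y Z i} (requestTime Y Z j) := by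
    refine ⟨⟨j, le_rfl, rfl⟩, ?_⟩
    rintro _ ⟨i, hi, rfl⟩
    exact hR (hD.le_iff_le.1 hi)
  have := deliveryTime_eq Y Z j
  rw [age, lastGeneration, hU.csSup_eq]
  linarith

/-- `Y_0, Y_1, …` are i.i.d. random variables on `(Ω, P)` with common law `μ`. -/
structure IsDelayProcess {Ω : Type*} [MeasurableSpace Ω] (P : Measure Ω) (μ : Measure ℝ)
    (Y : ℕ → Ω → ℝ) : Prop where
  measurable : ∀ j, Measurable (Y j)
  indep : iIndepFun Y P
  law : ∀ j, P.map (Y j) = μ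

/-- `Z = (Z_0, Z_1, …)` is a (possibly randomized, history-dependent) causal update policy with
waiting periods in `[0, M]`: `ℱ j` is the information available at the delivery point `D_j`. It
contains the delays `Y_0, …, Y_j` and the waiting periods `Z_0, …, Z_j`, possibly together with
private randomization, and it is independent of the next delay (hence, since the same holds at all
later stages, of all future delays). -/
structure IsCausalPolicy {Ω : Type*} [m : MeasurableSpace Ω] (P : Measure Ω) (M : ℝ)
    (Y Z : ℕ → Ω → ℝ) : Prop where
  mem_Icc : ∀ j ω, Z j ω ∈ Icc 0 M
  causal : ∃ ℱ : Filtration ℕ m,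
    (∀ j, Measurable[ℱ j] (Y j)) ∧ (∀ j, Measurable[ℱ j] (Z j)) ∧
      ∀ j, Indep (ℱ j) (MeasurableSpace.comap (Y (j + 1)) inferInstance) P

/-- The penalty `g(Δ(Q))` at the query, as a random variable. -/
noncomputable def queryPenalty {Ω : Type*} (g : ℝ → ℝ) (Q : ℝ) (Y Z : ℕ → Ω → ℝ) (ω : Ω) : ℝ :=
  g (age (fun j => Y j ω) (fun j => Z j ω) Q)

/-- `Z` is the policy `Z_j = z (Y_j, Q - D_j)`, where `Y_j = Δ(D_j)`. -/
def IsStationaryDeterministic {Ω : Type*} (z : ℝ × ℝ → ℝ) (Q : ℝ) (Y Z : ℕ → Ω → ℝ) : Prop :=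
  ∀ j ω, Z j ω = z (Y j ω, Q - deliveryTime (fun i => Y i ω) (fun i => Z i ω) j)

/-- `Z` attains the minimum of `E[g(Δ(Q))]` over all causal policies. -/
structure IsOptimal {Ω : Type*} [MeasurableSpace Ω] (P : Measure Ω) (M : ℝ) (g : ℝ → ℝ) (Q : ℝ)
    (Y Z : ℕ → Ω → ℝ) : Prop where
  isCausal : IsCausalPolicy P M Y Z
  integrable : Integrable (queryPenalty g Q Y Z) P
  le : ∀ Z' : ℕ → Ω → ℝ, IsCausalPolicy P M Y Z' →
    Integrable (queryPenalty g Q Y Z') P ∧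
      ∫ ω, queryPenalty g Q Y Z ω ∂P ≤ ∫ ω, queryPenalty g Q Y Z' ω ∂P

end PullOrWait

/-! The proof is dynamic programming on the state `(y, q)`: age at the latest delivery and time left
until the query. Almost every delay is at least `B = B_L`, so each delivery uses at least `B` of the
remaining time and only finitely many updates can matter. The finite-horizon values `iterValue n`
therefore stop changing once `n * B` exceeds `q`; their common value `value` satisfies a
horizon-free Bellman equation, which makes the optimal rule stationary. Replacing a delay `y` by
`max y B` makes this hold for every `y`, not just almost every one. A Borel minimizer exists because
the one-step cost is lower semicontinuous: the event of delivery by the query is closed, and on it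
the cost can only drop, `g` being nondecreasing. Fatou carries this through the expectation,
compactness of `[0, M]` through the infimum. For verification (`lintegral_costAt_le_succ`),
independence of the next delay makes the expected cost seen at successive deliveries nondecreasing
under any causal policy and constant under the minimizer. It starts at the mean of `value (Y 0, Q)`,
the same for all policies, and ends at the expected penalty. -/

namespace PullOrWait

open Filter Topology
open scoped ENNReal

/-! ### Lower semicontinuity and measurable selection -/

section Semicontinuity

/-- **Fatou's lemma** as lower semicontinuity of a parametric integral. -/
theorem lowerSemicontinuous_lintegral {X α : Type*} [TopologicalSpace X]
    [FirstCountableTopology X] [MeasurableSpace α] {μ : Measure α} {F : X → α → ℝ≥0∞}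
    (hF : ∀ a, LowerSemicontinuous fun x => F x a) (hm : ∀ x, Measurable (F x)) :
    LowerSemicontinuous fun x => ∫⁻ a, F x a ∂μ := by
  rw [lowerSemicontinuous_iff_le_liminf]
  intro x
  calc ∫⁻ a, F x a ∂μ ≤ ∫⁻ a, liminf (fun y => F y a) (𝓝 x) ∂μ :=
        lintegral_mono fun a => lowerSemicontinuous_iff_le_liminf.1 (hF a) x
    _ ≤ _ := lintegral_liminf_le hm

theorem lowerSemicontinuous_biInf_of_isCompact {X Z : Type*} [TopologicalSpace X]
    [TopologicalSpace Z] {H : X → Z → ℝ≥0∞} (hH : LowerSemicontinuous (Function.uncurry H))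
    {K : Set Z} (hK : IsCompact K) : LowerSemicontinuous fun x => ⨅ z ∈ K, H x z := by
  intro x t ht
  -- A uniform strict bound over `K` gives only a weak bound on the infimum, so an intermediate
  -- level is needed.
  obtain ⟨r, htr, hr⟩ := exists_between ht
  have : ∀ᶠ y in 𝓝 x, ∀ z ∈ K, r < H y z := by
    refine hK.eventually_forall_of_forall_eventually fun z hz => ?_
    exact hH (x, z) r (hr.trans_le (iInf₂_le z hz))
  filter_upwards [this] with y hy
  exact htr.trans_le (le_iInf₂ fun z hz => (hy z hz).le)

theorem exists_eq_biInf_of_isCompact {Z : Type*} [TopologicalSpace Z] {h : Z → ℝ≥0∞}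
    (hh : LowerSemicontinuous h) {K : Set Z} (hK : IsCompact K) (hne : K.Nonempty) :
    ∃ z ∈ K, h z = ⨅ z ∈ K, h z := by
  obtain ⟨z, hz, hmin⟩ := (hh.lowerSemicontinuousOn K).exists_isMinOn hne hK
  exact ⟨z, hz, le_antisymm (le_iInf₂ fun w hw => hmin hw) (iInf₂_le z hz)⟩

/-- A jointly lower semicontinuous function has a Borel selection of minimizers over a compact
interval: the least minimizer. -/
theorem exists_measurable_isMin_Icc {X : Type*} [TopologicalSpace X] [MeasurableSpace X]
    [OpensMeasurableSpace X] {H : X → ℝ → ℝ≥0∞} (hH : LowerSemicontinuous (Function.uncurry H))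
    {M : ℝ} (hM : 0 ≤ M) :
    ∃ z : X → ℝ, Measurable z ∧ (∀ x, z x ∈ Icc 0 M) ∧
      ∀ x, H x (z x) = ⨅ w ∈ Icc 0 M, H x w := by
  have hHx : ∀ x, LowerSemicontinuous (H x) := fun x =>
    hH.comp (g := fun w => (x, w)) (by fun_prop)
  set S : X → Set ℝ := fun x => Icc 0 M ∩ {w | H x w ≤ ⨅ w ∈ Icc 0 M, H x w} with hS
  have hScomp : ∀ x, IsCompact (S x) := fun x =>
    isCompact_Icc.inter_right ((hHx x).isClosed_preimage _)
  have hSne : ∀ x, (S x).Nonempty := fun x => by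
    obtain ⟨w, hw, h⟩ := exists_eq_biInf_of_isCompact (hHx x) isCompact_Icc
      (nonempty_Icc.2 hM)
    exact ⟨w, hw, h.le⟩
  have hmem : ∀ x, sInf (S x) ∈ S x := fun x => (hScomp x).sInf_mem (hSne x)
  refine ⟨fun x => sInf (S x), ?_, fun x => (hmem x).1,
    fun x => le_antisymm (hmem x).2 (iInf₂_le _ (hmem x).1)⟩
  refine measurable_of_Iic fun a => ?_
  by_cases ha : a < 0
  · convert MeasurableSet.empty
    ext x
    simpa using ha.trans_le (hmem x).1.1
  push Not at ha
  -- The least minimizer is at most `a` exactly when the minimum is already reached on `[0, min a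
  -- M]`; this compares two lower semicontinuous, hence Borel, functions.
  have : (fun x => sInf (S x)) ⁻¹' Iic a =
      {x | ⨅ w ∈ Icc 0 (min a M), H x w ≤ ⨅ w ∈ Icc 0 M, H x w} := by
    ext x
    simp only [mem_preimage, mem_Iic, mem_ofPred_eq]
    constructor
    · intro h
      exact (iInf₂_le _ ⟨(hmem x).1.1, le_min h (hmem x).1.2⟩).trans (hmem x).2
    · intro h
      obtain ⟨w, hw, hw'⟩ := exists_eq_biInf_of_isCompact (hHx x)
        (isCompact_Icc (a := 0) (b := min a M)) (nonempty_Icc.2 (le_min ha hM))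
      have hwS : w ∈ S x := ⟨⟨hw.1, hw.2.trans (min_le_right _ _)⟩, hw'.trans_le h⟩
      exact (csInf_le (hScomp x).bddBelow hwS).trans (hw.2.trans (min_le_left _ _))
  rw [this]
  exact measurableSet_le (lowerSemicontinuous_biInf_of_isCompact hH isCompact_Icc).measurable
    (lowerSemicontinuous_biInf_of_isCompact hH isCompact_Icc).measurable

end Semicontinuity

/-! ### Value iteration and the Bellman equation -/

section DynamicProgramming

/-- The penalty at the query if the state at the last delivery before it is `s = (y, q)`: age `y`,
remaining time `q`. -/
noncomputable def terminalCost (G : ℝ → ℝ≥0∞) (s : ℝ × ℝ) : ℝ≥0∞ :=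
  G (max s.1 0 + s.2)

/-- Cost after waiting `z` in state `s` and a next delay `max y B`, if `V` is the cost of the state
at the next delivery. -/
noncomputable def stepCost (G : ℝ → ℝ≥0∞) (B : ℝ) (V : ℝ × ℝ → ℝ≥0∞) (s : ℝ × ℝ) (z y : ℝ) :
    ℝ≥0∞ :=
  if max y B ≤ s.2 - z then V (max y B, s.2 - z - max y B) else terminalCost G s

/-- Expected cost of waiting `z` in state `s`. -/
noncomputable def actionCost (G : ℝ → ℝ≥0∞) (B : ℝ) (μ : Measure ℝ) (V : ℝ × ℝ → ℝ≥0∞)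
    (s : ℝ × ℝ) (z : ℝ) : ℝ≥0∞ :=
  ∫⁻ y, stepCost G B V s z y ∂μ

/-- Minimal expected cost when at most `n` further updates count. -/
noncomputable def iterValue (G : ℝ → ℝ≥0∞) (B M : ℝ) (μ : Measure ℝ) : ℕ → ℝ × ℝ → ℝ≥0∞
  | 0 => terminalCost G
  | n + 1 => fun s => ⨅ z ∈ Icc 0 M, actionCost G B μ (iterValue G B M μ n) s z

/-- The value function: with remaining time less than `n * B`, at most `n` updates count. -/
noncomputable def value (G : ℝ → ℝ≥0∞) (B M : ℝ) (μ : Measure ℝ) (s : ℝ × ℝ) : ℝ≥0∞ :=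
  iterValue G B M μ (⌊s.2 / B⌋₊ + 1) s

variable {G : ℝ → ℝ≥0∞} {B M : ℝ} {μ : Measure ℝ} {V : ℝ × ℝ → ℝ≥0∞}

theorem continuous_terminalCost (hG : Continuous G) : Continuous (terminalCost G) := by
  unfold terminalCost
  fun_prop

theorem le_terminalCost_of_step (hGm : Monotone G) (hB : 0 ≤ B)
    (hV : ∀ s, V s ≤ terminalCost G s) {s : ℝ × ℝ} {z : ℝ} (hz : 0 ≤ z) (y : ℝ) :
    V (max y B, s.2 - z - max y B) ≤ terminalCost G s := by
  refine (hV _).trans (hGm ?_)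
  have h1 : 0 ≤ max y B := hB.trans (le_max_right _ _)
  have h2 : 0 ≤ max s.1 0 := le_max_right _ _
  simp only [max_eq_left h1]
  linarith

theorem stepCost_le (hGm : Monotone G) (hB : 0 ≤ B)
    (hV : ∀ s, V s ≤ terminalCost G s) {s : ℝ × ℝ} {z : ℝ} (hz : 0 ≤ z) (y : ℝ) :
    stepCost G B V s z y ≤ terminalCost G s := by
  unfold stepCost
  split_ifs
  · exact le_terminalCost_of_step hGm hB hV hz y
  · exact le_rfl

/-- Truncating the waiting period at `0` makes `stepCost` jointly lower semicontinuous: a delivery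
at the query itself still counts, and receiving an update never hurts. -/
theorem lowerSemicontinuous_stepCost (hG : Continuous G) (hGm : Monotone G) (hB : 0 ≤ B)
    (hV : ∀ s, V s ≤ terminalCost G s) (hVl : LowerSemicontinuous V) (y : ℝ) :
    LowerSemicontinuous fun x : (ℝ × ℝ) × ℝ => stepCost G B V x.1 (max x.2 0) y := by
  rintro ⟨s, z⟩ t ht
  have hc : ∀ t < terminalCost G s, ∀ᶠ x : (ℝ × ℝ) × ℝ in 𝓝 (s, z), t < terminalCost G x.1 :=
    fun t ht => ((continuous_terminalCost hG).comp continuous_fst).lowerSemicontinuous (s, z) t ht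
  by_cases h : max y B ≤ s.2 - max z 0
  · simp only [stepCost, if_pos h] at ht
    have hV' : LowerSemicontinuous fun x : (ℝ × ℝ) × ℝ =>
        V (max y B, x.1.2 - max x.2 0 - max y B) :=
      hVl.comp (g := fun x : (ℝ × ℝ) × ℝ => (max y B, x.1.2 - max x.2 0 - max y B)) (by fun_prop)
    -- Nearby points may fall in either branch, so both branch values must exceed `t`.
    filter_upwards [hV' (s, z) t ht, hc t (ht.trans_le
      (le_terminalCost_of_step hGm hB hV (le_max_right z 0) y))] with x h1 h2
    unfold stepCost
    split_ifs
    exacts [h1, h2]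
  · simp only [stepCost, if_neg h] at ht
    have ho : IsOpen {x : (ℝ × ℝ) × ℝ | ¬ max y B ≤ x.1.2 - max x.2 0} := by
      simp only [not_le]
      exact isOpen_lt (by fun_prop) (by fun_prop)
    filter_upwards [hc t ht, ho.mem_nhds h] with x h1 h2
    rw [stepCost, if_neg h2]
    exact h1

theorem measurable_stepCost (hG : Continuous G) (hV : Measurable V) :
    Measurable fun x : ((ℝ × ℝ) × ℝ) × ℝ => stepCost G B V x.1.1 x.1.2 x.2 := by
  unfold stepCost
  refine Measurable.ite (measurableSet_le (by fun_prop) (by fun_prop)) (by fun_prop) ?_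
  exact (continuous_terminalCost hG).measurable.comp (by fun_prop)

theorem lowerSemicontinuous_actionCost (hG : Continuous G) (hGm : Monotone G) (hB : 0 ≤ B)
    (hV : ∀ s, V s ≤ terminalCost G s) (hVl : LowerSemicontinuous V) :
    LowerSemicontinuous fun x : (ℝ × ℝ) × ℝ => actionCost G B μ V x.1 (max x.2 0) :=
  lowerSemicontinuous_lintegral (lowerSemicontinuous_stepCost hG hGm hB hV hVl) fun x =>
    (measurable_stepCost hG hVl.measurable).comp (g := fun x : ((ℝ × ℝ) × ℝ) × ℝ =>
      stepCost G B V x.1.1 x.1.2 x.2) (f := fun y => ((x.1, max x.2 0), y)) (by fun_prop)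

/-- Passes to the truncated form, for which lower semicontinuity holds on all of `ℝ`. -/
theorem biInf_actionCost_eq (s : ℝ × ℝ) :
    ⨅ z ∈ Icc 0 M, actionCost G B μ V s z =
      ⨅ z ∈ Icc 0 M, actionCost G B μ V s (max z 0) :=
  biInf_congr fun z hz => by rw [max_eq_left hz.1]

/-- Both claims go through one induction, since semicontinuity of the next iterate needs the upper
bound on the current one. Waiting `0` gives the bound. -/
theorem iterValue_le_and_lowerSemicontinuous [IsProbabilityMeasure μ] (hG : Continuous G)
    (hGm : Monotone G) (hB : 0 ≤ B) (hM : 0 ≤ M) (n : ℕ) :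
    (∀ s, iterValue G B M μ n s ≤ terminalCost G s) ∧
      LowerSemicontinuous (iterValue G B M μ n) := by
  induction n with
  | zero => exact ⟨fun s => le_rfl, (continuous_terminalCost hG).lowerSemicontinuous⟩
  | succ n ih =>
    refine ⟨fun s => ?_, ?_⟩
    · refine (iInf₂_le 0 ⟨le_rfl, hM⟩).trans ?_
      refine (lintegral_mono fun y => stepCost_le hGm hB ih.1 le_rfl y).trans ?_
      simp
    · simp only [iterValue, biInf_actionCost_eq]
      exact lowerSemicontinuous_biInf_of_isCompact
        (lowerSemicontinuous_actionCost hG hGm hB ih.1 ih.2) isCompact_Icc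

/-- A delivery uses at least `B` of the remaining time, so later states all lie where `V` and `V'`
agree. -/
theorem actionCost_congr {V V' : ℝ × ℝ → ℝ≥0∞} {n : ℕ}
    (h : ∀ s : ℝ × ℝ, s.2 < n * B → V s = V' s) {s : ℝ × ℝ} (hs : s.2 < (n + 1) * B) {z : ℝ}
    (hz : 0 ≤ z) : actionCost G B μ V s z = actionCost G B μ V' s z := by
  refine lintegral_congr fun y => ?_
  unfold stepCost
  split_ifs
  · refine h _ ?_
    have := le_max_right y B
    simp only
    linarith
  · rfl

theorem iterValue_succ_eq [IsProbabilityMeasure μ] (hB : 0 < B) (hM : 0 ≤ M) (n : ℕ) :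
    ∀ s : ℝ × ℝ, s.2 < n * B → iterValue G B M μ (n + 1) s = iterValue G B M μ n s := by
  induction n with
  | zero =>
    intro s hs
    -- Here the remaining time is negative, so no further delivery counts.
    have hz : ∀ z ∈ Icc 0 M, actionCost G B μ (iterValue G B M μ 0) s z = terminalCost G s := by
      intro z hz
      have : ∀ y, stepCost G B (iterValue G B M μ 0) s z y = terminalCost G s := fun y => by
        refine if_neg ?_
        have := le_max_right y B
        have := hz.1
        simp only [Nat.cast_zero, zero_mul] at hs
        linarith
      simp [actionCost, this]
    exact (biInf_congr hz).trans (biInf_const (nonempty_Icc.2 hM))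
  | succ n ih =>
    intro s hs
    push_cast at hs
    exact biInf_congr fun z hz => actionCost_congr ih hs hz.1

theorem iterValue_eq_of_le [IsProbabilityMeasure μ] (hB : 0 < B) (hM : 0 ≤ M) {m n : ℕ}
    (hmn : m ≤ n) {s : ℝ × ℝ} (hs : s.2 < m * B) :
    iterValue G B M μ n s = iterValue G B M μ m s := by
  induction n, hmn using Nat.le_induction with
  | base => rfl
  | succ n hn ih =>
    rw [iterValue_succ_eq hB hM n s, ih]
    have : (m : ℝ) * B ≤ n * B := by gcongr
    exact hs.trans_le this

theorem lt_floor_div_succ_mul (hB : 0 < B) (q : ℝ) : q < ((⌊q / B⌋₊ + 1 : ℕ) : ℝ) * B := by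
  have := Nat.lt_floor_add_one (q / B)
  rw [div_lt_iff₀ hB] at this
  exact_mod_cast this

theorem value_eq_iterValue [IsProbabilityMeasure μ] (hB : 0 < B) (hM : 0 ≤ M) {n : ℕ}
    {s : ℝ × ℝ} (hs : s.2 < n * B) : value G B M μ s = iterValue G B M μ n s := by
  rcases le_total n (⌊s.2 / B⌋₊ + 1) with h | h
  · exact iterValue_eq_of_le hB hM h hs
  · exact (iterValue_eq_of_le hB hM h (lt_floor_div_succ_mul hB s.2)).symm

theorem value_le [IsProbabilityMeasure μ] (hG : Continuous G) (hGm : Monotone G) (hB : 0 < B)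
    (hM : 0 ≤ M) (s : ℝ × ℝ) : value G B M μ s ≤ terminalCost G s :=
  (iterValue_le_and_lowerSemicontinuous hG hGm hB.le hM _).1 s

theorem lowerSemicontinuous_value [IsProbabilityMeasure μ] (hG : Continuous G) (hGm : Monotone G)
    (hB : 0 < B) (hM : 0 ≤ M) : LowerSemicontinuous (value G B M μ) := by
  intro s t ht
  have hs := lt_floor_div_succ_mul hB s.2
  have ho : IsOpen {s' : ℝ × ℝ | s'.2 < ((⌊s.2 / B⌋₊ + 1 : ℕ) : ℝ) * B} :=
    isOpen_lt (by fun_prop) (by fun_prop)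
  filter_upwards [(iterValue_le_and_lowerSemicontinuous hG hGm hB.le hM _).2 s t ht,
    ho.mem_nhds hs] with s' h1 h2
  rwa [value_eq_iterValue hB hM h2]

/-- The **Bellman equation**. -/
theorem value_eq_biInf [IsProbabilityMeasure μ] (hB : 0 < B) (hM : 0 ≤ M) (s : ℝ × ℝ) :
    value G B M μ s = ⨅ z ∈ Icc 0 M, actionCost G B μ (value G B M μ) s z := by
  have hs := lt_floor_div_succ_mul hB s.2
  push_cast at hs
  -- The `+ 1` in `value` exposes one Bellman step by definition; the remaining iterate agrees with
  -- `value` wherever that step can lead.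
  exact biInf_congr fun z hz =>
    actionCost_congr (fun _ h => (value_eq_iterValue hB hM h).symm) hs hz.1

/-- A Borel choice of optimal waiting periods. -/
theorem exists_measurable_actionCost_eq_value [IsProbabilityMeasure μ] (hG : Continuous G)
    (hGm : Monotone G) (hB : 0 < B) (hM : 0 ≤ M) :
    ∃ z : ℝ × ℝ → ℝ, Measurable z ∧ (∀ s, z s ∈ Icc 0 M) ∧
      ∀ s, actionCost G B μ (value G B M μ) s (z s) = value G B M μ s := by
  obtain ⟨z, hzm, hz, h⟩ := exists_measurable_isMin_Icc
    (H := fun s z => actionCost G B μ (value G B M μ) s (max z 0))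
    (lowerSemicontinuous_actionCost hG hGm hB.le (value_le hG hGm hB hM)
      (lowerSemicontinuous_value hG hGm hB hM)) hM
  refine ⟨z, hzm, hz, fun s => ?_⟩
  rw [value_eq_biInf hB hM, biInf_actionCost_eq, ← h, max_eq_left (hz s).1]

end DynamicProgramming

/-! ### Age and cost along a single path -/

section Paths

variable {Y Z : ℕ → ℝ} {Q : ℝ}

theorem strictMono_deliveryTime (hY : ∀ j, 0 < Y j) (hZ : ∀ j, 0 ≤ Z j) :
    StrictMono (deliveryTime Y Z) := strictMono_nat_of_lt_succ fun i => by
  have := hY (i + 1)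
  have := hZ i
  simp only [deliveryTime]
  linarith

theorem monotone_requestTime (hY : ∀ j, 0 < Y j) (hZ : ∀ j, 0 ≤ Z j) :
    Monotone (requestTime Y Z) := monotone_nat_of_le_succ fun i => by
  have := hY i
  have := hZ i
  have := deliveryTime_eq Y Z i
  have : requestTime Y Z (i + 1) = deliveryTime Y Z i + Z i := rfl
  linarith

theorem mul_le_deliveryTime {B : ℝ} (hY : ∀ j, B ≤ Y j) (hZ : ∀ j, 0 ≤ Z j) (j : ℕ) :
    j * B ≤ deliveryTime Y Z j := by
  induction j with
  | zero => simp [deliveryTime]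
  | succ j ih =>
    have := hY (j + 1)
    have := hZ j
    simp only [deliveryTime]
    push_cast
    linarith

/-- Between two deliveries the age grows linearly. -/
theorem age_eq_of_le_of_lt (hY : ∀ j, 0 < Y j) (hZ : ∀ j, 0 ≤ Z j) {j : ℕ}
    (h : deliveryTime Y Z j ≤ Q) (h' : Q < deliveryTime Y Z (j + 1)) :
    age Y Z Q = Y j + (Q - deliveryTime Y Z j) := by
  have hU : IsGreatest {r | ∃ i, deliveryTime Y Z i ≤ Q ∧ r = requestTime Y Z i}
      (requestTime Y Z j) := by
    refine ⟨⟨j, h, rfl⟩, ?_⟩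
    rintro _ ⟨i, hi, rfl⟩
    exact monotone_requestTime hY hZ (Nat.lt_succ_iff.1
      ((strictMono_deliveryTime hY hZ).lt_iff_lt.1 (hi.trans_lt h')))
  have := deliveryTime_eq Y Z j
  rw [age, lastGeneration, hU.csSup_eq]
  linarith

theorem age_mem_Icc (hY : ∀ j, 0 < Y j) (hQ : 0 ≤ Q) : age Y Z Q ∈ Icc 0 (Q + Y 0) := by
  have h0 : -Y 0 ∈ {r | ∃ i, deliveryTime Y Z i ≤ Q ∧ r = requestTime Y Z i} := ⟨0, hQ, rfl⟩
  have hb : ∀ r ∈ {r | ∃ i, deliveryTime Y Z i ≤ Q ∧ r = requestTime Y Z i}, r ≤ Q := by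
    rintro _ ⟨i, hi, rfl⟩
    have := deliveryTime_eq Y Z i
    have := hY i
    linarith
  have h1 := le_csSup ⟨Q, hb⟩ h0
  have h2 := csSup_le ⟨_, h0⟩ hb
  constructor <;> simp only [age, lastGeneration] <;> linarith

/-- Update `0` is always delivered by `Q`, so its request time is a harmless filler for undelivered
indices. The countable supremum yields measurability of the age. -/
theorem lastGeneration_eq_iSup (hQ : 0 ≤ Q) :
    lastGeneration Y Z Q =
      ⨆ j, if deliveryTime Y Z j ≤ Q then requestTime Y Z j else requestTime Y Z 0 := by
  unfold lastGeneration iSup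
  congr 1
  ext r
  constructor
  · rintro ⟨j, hj, rfl⟩
    exact ⟨j, if_pos hj⟩
  · rintro ⟨j, rfl⟩
    by_cases hj : deliveryTime Y Z j ≤ Q
    · exact ⟨j, hj, if_pos hj⟩
    · exact ⟨0, hQ, if_neg hj⟩

/-- Cost along a path as seen at the `j`-th delivery: the value of the current state, or the
realized penalty if the query has already occurred. -/
noncomputable def costAt (G : ℝ → ℝ≥0∞) (V : ℝ × ℝ → ℝ≥0∞) (Q : ℝ) (Y Z : ℕ → ℝ) (j : ℕ) :
    ℝ≥0∞ :=
  if deliveryTime Y Z j ≤ Q then V (Y j, Q - deliveryTime Y Z j) else G (age Y Z Q)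

variable {G : ℝ → ℝ≥0∞} {V : ℝ × ℝ → ℝ≥0∞} {B : ℝ}

theorem costAt_succ_of_le (hB : 0 < B) (hY : ∀ j, B ≤ Y j) (hZ : ∀ j, 0 ≤ Z j) {j : ℕ}
    (h : deliveryTime Y Z j ≤ Q) :
    costAt G V Q Y Z (j + 1) = stepCost G B V (Y j, Q - deliveryTime Y Z j) (Z j) (Y (j + 1)) := by
  have hpos : ∀ j, 0 < Y j := fun j => hB.trans_le (hY j)
  have hD : deliveryTime Y Z (j + 1) = deliveryTime Y Z j + Z j + Y (j + 1) := rfl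
  have hiff : Y (j + 1) ≤ Q - deliveryTime Y Z j - Z j ↔ deliveryTime Y Z (j + 1) ≤ Q := by
    rw [hD]
    constructor <;> intro h <;> linarith
  simp only [stepCost, max_eq_left (hY (j + 1)), hiff, costAt]
  split_ifs with h'
  · congr 2
    rw [hD]
    ring
  · rw [terminalCost, age_eq_of_le_of_lt hpos hZ h (not_le.1 h'), max_eq_left (hpos j).le]

theorem costAt_succ_of_lt (hY : ∀ j, 0 < Y j) (hZ : ∀ j, 0 ≤ Z j) {j : ℕ}
    (h : Q < deliveryTime Y Z j) : costAt G V Q Y Z (j + 1) = costAt G V Q Y Z j := by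
  rw [costAt, costAt, if_neg (not_le.2 h),
    if_neg (not_le.2 (h.trans (strictMono_deliveryTime hY hZ j.lt_succ_self)))]

end Paths

/-! ### Verification: optimality from the Bellman equation -/

section Verification

/-- Integrating out a variable that is independent of the conditioning information. -/
theorem lintegral_indep {Ω E F : Type*} {m' m : MeasurableSpace Ω} [MeasurableSpace E]
    [MeasurableSpace F] {P : Measure Ω} [IsProbabilityMeasure P] (hm : m' ≤ m) {X : Ω → E}
    {Y : Ω → F} (hX : Measurable[m'] X) (hY : Measurable Y)
    (hind : Indep m' (MeasurableSpace.comap Y inferInstance) P) {Φ : E × F → ℝ≥0∞}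
    (hΦ : Measurable Φ) :
    ∫⁻ ω, Φ (X ω, Y ω) ∂P = ∫⁻ ω, ∫⁻ y, Φ (X ω, y) ∂(P.map Y) ∂P := by
  have hX' : Measurable X := hX.mono hm le_rfl
  have hXY : IndepFun X Y P := indep_of_indep_of_le_left hind hX.comap_le
  have := Measure.isProbabilityMeasure_map (μ := P) hY.aemeasurable
  rw [← lintegral_map hΦ (hX'.prodMk hY), hXY.map_prod_eq_prod_map_map hX'.aemeasurable
    hY.aemeasurable, lintegral_prod _ hΦ.aemeasurable, lintegral_map hΦ.lintegral_prod_right' hX']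

variable {Ω : Type*} [m : MeasurableSpace Ω] {P : Measure Ω} {μ : Measure ℝ} {B M Q : ℝ}
  {Y Z : ℕ → Ω → ℝ} {G : ℝ → ℝ≥0∞}

theorem measurable_deliveryTime {ℱ : Filtration ℕ m} (hY : ∀ j, Measurable[ℱ j] (Y j))
    (hZ : ∀ j, Measurable[ℱ j] (Z j)) (j : ℕ) :
    Measurable[ℱ j] fun ω => deliveryTime (fun i => Y i ω) (fun i => Z i ω) j := by
  induction j with
  | zero => exact measurable_const
  | succ j ih =>
    have hle := ℱ.mono j.le_succ
    exact ((ih.mono hle le_rfl).add ((hZ j).mono hle le_rfl)).add (hY (j + 1))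

variable {V : ℝ × ℝ → ℝ≥0∞}

theorem lintegral_costAt_eq_of_lt {N : ℕ} (hN : Q < N * B) (hY : ∀ᵐ ω ∂P, ∀ j, B ≤ Y j ω)
    (hZ : ∀ j ω, 0 ≤ Z j ω) :
    ∫⁻ ω, costAt G V Q (fun i => Y i ω) (fun i => Z i ω) N ∂P =
      ∫⁻ ω, G (age (fun i => Y i ω) (fun i => Z i ω) Q) ∂P := by
  refine lintegral_congr_ae ?_
  filter_upwards [hY] with ω hω
  exact if_neg (not_le.2 (hN.trans_le (mul_le_deliveryTime hω (fun j => hZ j ω) N)))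

variable [IsProbabilityMeasure P]

theorem setLIntegral_costAt_succ (hB : 0 < B) (hG : Continuous G) (hV : Measurable V)
    {ℱ : Filtration ℕ m} (hYm : ∀ j, Measurable[ℱ j] (Y j)) (hZm : ∀ j, Measurable[ℱ j] (Z j))
    (hind : ∀ j, Indep (ℱ j) (MeasurableSpace.comap (Y (j + 1)) inferInstance) P)
    (hlaw : ∀ j, P.map (Y j) = μ) (hY : ∀ᵐ ω ∂P, ∀ j, B ≤ Y j ω) (hZ : ∀ j ω, 0 ≤ Z j ω) (j : ℕ) :
    ∫⁻ ω in {ω | deliveryTime (fun i => Y i ω) (fun i => Z i ω) j ≤ Q},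
        costAt G V Q (fun i => Y i ω) (fun i => Z i ω) (j + 1) ∂P =
      ∫⁻ ω in {ω | deliveryTime (fun i => Y i ω) (fun i => Z i ω) j ≤ Q},
        actionCost G B μ V
          (Y j ω, Q - deliveryTime (fun i => Y i ω) (fun i => Z i ω) j) (Z j ω) ∂P := by
  set D : Ω → ℝ := fun ω => deliveryTime (fun i => Y i ω) (fun i => Z i ω) j
  have hD : Measurable[ℱ j] D := measurable_deliveryTime hYm hZm j
  have hA : MeasurableSet {ω | D ω ≤ Q} :=
    measurableSet_le (hD.mono (ℱ.le j) le_rfl) measurable_const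
  have hX : Measurable[ℱ j] fun ω => ((Y j ω, Q - D ω), Z j ω) :=
    ((hYm j).prodMk (hD.const_sub Q)).prodMk (hZm j)
  -- Encoding `D ω ≤ Q` as a condition on the state makes the restricted integrand a function of `ℱ
  -- j`-measurable data and the next delay, as `lintegral_indep` requires.
  set S : Set (((ℝ × ℝ) × ℝ) × ℝ) := {x | 0 ≤ x.1.1.2}
  have hS : MeasurableSet S := measurableSet_le measurable_const (by fun_prop)
  have key := lintegral_indep (ℱ.le j) hX ((hYm (j + 1)).mono (ℱ.le _) le_rfl) (hind j)
    ((measurable_stepCost (B := B) hG hV).indicator hS)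
  rw [hlaw] at key
  rw [← lintegral_indicator hA, ← lintegral_indicator hA]
  refine (lintegral_congr_ae ?_).trans (key.trans (lintegral_congr fun ω => ?_))
  · filter_upwards [hY] with ω hω
    by_cases h : D ω ≤ Q
    · rw [indicator_of_mem (show ω ∈ {ω | D ω ≤ Q} from h),
        indicator_of_mem (show _ ∈ S from sub_nonneg.2 h)]
      exact costAt_succ_of_le hB hω (fun j => hZ j ω) h
    · rw [indicator_of_notMem (show ω ∉ {ω | D ω ≤ Q} from h),
        indicator_of_notMem (show _ ∉ S from fun h' => h (sub_nonneg.1 h'))]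
  · by_cases h : D ω ≤ Q
    · rw [indicator_of_mem (show ω ∈ {ω | D ω ≤ Q} from h)]
      exact lintegral_congr fun y => indicator_of_mem (show _ ∈ S from sub_nonneg.2 h) _
    · rw [indicator_of_notMem (show ω ∉ {ω | D ω ≤ Q} from h)]
      refine (lintegral_congr fun y => indicator_of_notMem
        (show _ ∉ S from fun h' => h (sub_nonneg.1 h')) _).trans lintegral_zero

/-- Under a causal policy the expected cost seen at successive deliveries is nondecreasing, and
constant if every waiting period is optimal. -/
theorem lintegral_costAt_le_succ (hB : 0 < B) (hG : Continuous G) (hV : Measurable V)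
    {ℱ : Filtration ℕ m} (hYm : ∀ j, Measurable[ℱ j] (Y j)) (hZm : ∀ j, Measurable[ℱ j] (Z j))
    (hind : ∀ j, Indep (ℱ j) (MeasurableSpace.comap (Y (j + 1)) inferInstance) P)
    (hlaw : ∀ j, P.map (Y j) = μ) (hY : ∀ᵐ ω ∂P, ∀ j, B ≤ Y j ω) (hZ : ∀ j ω, Z j ω ∈ Icc 0 M)
    (hVle : ∀ s, ∀ z ∈ Icc 0 M, V s ≤ actionCost G B μ V s z) (j : ℕ) :
    ∫⁻ ω, costAt G V Q (fun i => Y i ω) (fun i => Z i ω) j ∂P ≤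
        ∫⁻ ω, costAt G V Q (fun i => Y i ω) (fun i => Z i ω) (j + 1) ∂P ∧
      ((∀ ω, actionCost G B μ V (Y j ω, Q - deliveryTime (fun i => Y i ω) (fun i => Z i ω) j)
          (Z j ω) = V (Y j ω, Q - deliveryTime (fun i => Y i ω) (fun i => Z i ω) j)) →
        ∫⁻ ω, costAt G V Q (fun i => Y i ω) (fun i => Z i ω) j ∂P =
          ∫⁻ ω, costAt G V Q (fun i => Y i ω) (fun i => Z i ω) (j + 1) ∂P) := by
  have hA : MeasurableSet {ω | deliveryTime (fun i => Y i ω) (fun i => Z i ω) j ≤ Q} :=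
    measurableSet_le ((measurable_deliveryTime hYm hZm j).mono (ℱ.le j) le_rfl) measurable_const
  have hcompl : ∫⁻ ω in {ω | deliveryTime (fun i => Y i ω) (fun i => Z i ω) j ≤ Q}ᶜ,
        costAt G V Q (fun i => Y i ω) (fun i => Z i ω) j ∂P =
      ∫⁻ ω in {ω | deliveryTime (fun i => Y i ω) (fun i => Z i ω) j ≤ Q}ᶜ,
        costAt G V Q (fun i => Y i ω) (fun i => Z i ω) (j + 1) ∂P := by
    refine setLIntegral_congr_fun_ae hA.compl ?_
    filter_upwards [hY] with ω hω h
    exact (costAt_succ_of_lt (fun i => hB.trans_le (hω i)) (fun i => (hZ i ω).1)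
      (not_le.1 h)).symm
  have hself : ∫⁻ ω in {ω | deliveryTime (fun i => Y i ω) (fun i => Z i ω) j ≤ Q},
        costAt G V Q (fun i => Y i ω) (fun i => Z i ω) j ∂P =
      ∫⁻ ω in {ω | deliveryTime (fun i => Y i ω) (fun i => Z i ω) j ≤ Q},
        V (Y j ω, Q - deliveryTime (fun i => Y i ω) (fun i => Z i ω) j) ∂P :=
    setLIntegral_congr_fun hA fun ω h => if_pos h
  have hsucc := setLIntegral_costAt_succ (Q := Q) hB hG hV hYm hZm hind hlaw hY
    (fun j ω => (hZ j ω).1) j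
  rw [← lintegral_add_compl (fun ω => costAt G V Q (fun i => Y i ω) (fun i => Z i ω) j) hA,
    ← lintegral_add_compl (fun ω => costAt G V Q (fun i => Y i ω) (fun i => Z i ω) (j + 1)) hA,
    hcompl, hself, hsucc]
  refine ⟨?_, fun h => ?_⟩
  · gcongr with ω
    exact hVle _ _ (hZ j ω)
  · simp only [h]

/-- The expected value of the initial state bounds the expected penalty of every causal policy
from below. -/
theorem lintegral_value_le [IsProbabilityMeasure μ] (hB : 0 < B) (hM : 0 ≤ M) (hQ : 0 ≤ Q)
    (hG : Continuous G) (hGm : Monotone G) (hlaw : ∀ j, P.map (Y j) = μ)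
    (hY : ∀ᵐ ω ∂P, ∀ j, B ≤ Y j ω) (hZ : IsCausalPolicy P M Y Z) :
    ∫⁻ ω, value G B M μ (Y 0 ω, Q) ∂P ≤
      ∫⁻ ω, G (age (fun i => Y i ω) (fun i => Z i ω) Q) ∂P := by
  obtain ⟨ℱ, hYm, hZm, hind⟩ := hZ.causal
  rw [← lintegral_costAt_eq_of_lt (V := value G B M μ) (lt_floor_div_succ_mul hB Q) hY
    fun j ω => (hZ.mem_Icc j ω).1]
  have hmono : Monotone fun j =>
      ∫⁻ ω, costAt G (value G B M μ) Q (fun i => Y i ω) (fun i => Z i ω) j ∂P :=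
    monotone_nat_of_le_succ fun j => (lintegral_costAt_le_succ hB hG
      (lowerSemicontinuous_value hG hGm hB hM).measurable hYm hZm hind hlaw hY hZ.mem_Icc
      (fun s z hz => (value_eq_biInf hB hM s).trans_le (iInf₂_le z hz)) j).1
  refine le_trans (le_of_eq ?_) (hmono (Nat.zero_le _))
  simp [costAt, deliveryTime, hQ]

/-- A causal policy using optimal waiting periods attains the expected value of the initial
state. -/
theorem lintegral_value_eq [IsProbabilityMeasure μ] (hB : 0 < B) (hM : 0 ≤ M) (hQ : 0 ≤ Q)
    (hG : Continuous G) (hGm : Monotone G) (hlaw : ∀ j, P.map (Y j) = μ)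
    (hY : ∀ᵐ ω ∂P, ∀ j, B ≤ Y j ω) (hZ : IsCausalPolicy P M Y Z) {z : ℝ × ℝ → ℝ}
    (hz : ∀ s, actionCost G B μ (value G B M μ) s (z s) = value G B M μ s)
    (hst : IsStationaryDeterministic z Q Y Z) :
    ∫⁻ ω, value G B M μ (Y 0 ω, Q) ∂P =
      ∫⁻ ω, G (age (fun i => Y i ω) (fun i => Z i ω) Q) ∂P := by
  obtain ⟨ℱ, hYm, hZm, hind⟩ := hZ.causal
  rw [← lintegral_costAt_eq_of_lt (V := value G B M μ) (lt_floor_div_succ_mul hB Q) hY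
    fun j ω => (hZ.mem_Icc j ω).1]
  have hconst : ∀ j, ∫⁻ ω, costAt G (value G B M μ) Q (fun i => Y i ω) (fun i => Z i ω) 0 ∂P =
      ∫⁻ ω, costAt G (value G B M μ) Q (fun i => Y i ω) (fun i => Z i ω) j ∂P := by
    intro j
    induction j with
    | zero => rfl
    | succ j ih =>
      refine ih.trans ((lintegral_costAt_le_succ hB hG
        (lowerSemicontinuous_value hG hGm hB hM).measurable hYm hZm hind hlaw hY hZ.mem_Icc
        (fun s z hz => (value_eq_biInf hB hM s).trans_le (iInf₂_le z hz)) j).2 fun ω => ?_)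
      rw [hst j ω, hz]
  refine Eq.trans ?_ (hconst _)
  simp [costAt, deliveryTime, hQ]

end Verification

/-! ### Construction and causality of the stationary policy -/

section StationaryPolicy

/-- Delivery times under the policy `Z_j = z (Y_j, Q - D_j)`. -/
noncomputable def stationaryDelivery (z : ℝ × ℝ → ℝ) (Q : ℝ) (Y : ℕ → ℝ) : ℕ → ℝ
  | 0 => 0
  | j + 1 => stationaryDelivery z Q Y j + z (Y j, Q - stationaryDelivery z Q Y j) + Y (j + 1)

/-- The policy `Z_j = z (Y_j, Q - D_j)`. -/
noncomputable def stationaryPolicy {Ω : Type*} (z : ℝ × ℝ → ℝ) (Q : ℝ) (Y : ℕ → Ω → ℝ) (j : ℕ)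
    (ω : Ω) : ℝ :=
  z (Y j ω, Q - stationaryDelivery z Q (fun i => Y i ω) j)

/-- `stationaryDelivery` recurses on the delays alone, which removes the circularity between waiting
periods and delivery times. -/
theorem deliveryTime_stationaryPolicy {Ω : Type*} (z : ℝ × ℝ → ℝ) (Q : ℝ) (Y : ℕ → Ω → ℝ) (ω : Ω)
    (j : ℕ) : deliveryTime (fun i => Y i ω) (fun i => stationaryPolicy z Q Y i ω) j =
      stationaryDelivery z Q (fun i => Y i ω) j := by
  induction j with
  | zero => rfl
  | succ j ih => rw [deliveryTime, ih]; rfl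

theorem isStationaryDeterministic_stationaryPolicy {Ω : Type*} (z : ℝ × ℝ → ℝ) (Q : ℝ)
    (Y : ℕ → Ω → ℝ) : IsStationaryDeterministic z Q Y (stationaryPolicy z Q Y) := fun j ω => by
  rw [deliveryTime_stationaryPolicy]
  rfl

/-- The natural filtration of the delays suffices, as the policy uses no private randomization. -/
theorem isCausalPolicy_stationaryPolicy {Ω : Type*} [m : MeasurableSpace Ω] {P : Measure Ω}
    {μ : Measure ℝ} {M : ℝ} {Y : ℕ → Ω → ℝ} (hY : IsDelayProcess P μ Y) {z : ℝ × ℝ → ℝ}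
    (hz : Measurable z) (hzM : ∀ s, z s ∈ Icc 0 M) (Q : ℝ) :
    IsCausalPolicy P M Y (stationaryPolicy z Q Y) := by
  have hYs : ∀ j, StronglyMeasurable (Y j) := fun j => (hY.measurable j).stronglyMeasurable
  set ℱ := Filtration.natural Y hYs
  have hYm : ∀ j, Measurable[ℱ j] (Y j) := fun j =>
    (Filtration.stronglyAdapted_natural hYs j).measurable
  have hD : ∀ j, Measurable[ℱ j] fun ω => stationaryDelivery z Q (fun i => Y i ω) j := by
    intro j
    induction j with
    | zero => exact measurable_const
    | succ j ih =>
      have hle := ℱ.mono j.le_succ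
      have hzj : Measurable[ℱ j] fun ω =>
          z (Y j ω, Q - stationaryDelivery z Q (fun i => Y i ω) j) :=
        hz.comp ((hYm j).prodMk (ih.const_sub Q))
      exact ((ih.mono hle le_rfl).add (hzj.mono hle le_rfl)).add (hYm (j + 1))
  refine ⟨fun j ω => hzM _, ℱ, hYm, fun j => hz.comp ((hYm j).prodMk ((hD j).const_sub Q)),
    fun j => ?_⟩
  exact (hY.indep.indep_comap_natural_of_lt hYs j.lt_succ_self).symm

end StationaryPolicy

/-! ### Integrability of the penalty -/

section Integrability

variable {Ω : Type*} [MeasurableSpace Ω] {P : Measure Ω} {Q : ℝ} {Y Z : ℕ → Ω → ℝ}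

theorem measurable_age (hY : ∀ j, Measurable (Y j)) (hZ : ∀ j, Measurable (Z j)) (hQ : 0 ≤ Q) :
    Measurable fun ω => age (fun i => Y i ω) (fun i => Z i ω) Q := by
  have hD : ∀ j, Measurable fun ω => deliveryTime (fun i => Y i ω) (fun i => Z i ω) j := by
    intro j
    induction j with
    | zero => exact measurable_const
    | succ j ih => exact (ih.add (hZ j)).add (hY (j + 1))
  have hR : ∀ j, Measurable fun ω => requestTime (fun i => Y i ω) (fun i => Z i ω) j := by
    intro j
    cases j with
    | zero => exact (hY 0).neg
    | succ j => exact (hD j).add (hZ j)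
  simp only [age, lastGeneration_eq_iSup hQ]
  refine Measurable.const_sub (Measurable.iSup fun j => ?_) Q
  exact Measurable.ite (measurableSet_le (hD j) measurable_const) (hR j) (hR 0)

theorem IsCausalPolicy.measurable {M : ℝ} (hZ : IsCausalPolicy P M Y Z) (j : ℕ) :
    Measurable (Z j) := by
  obtain ⟨ℱ, -, hZm, -⟩ := hZ.causal
  exact (hZm j).mono (ℱ.le j) le_rfl

theorem integrable_queryPenalty [IsFiniteMeasure P] {B_U : ℝ} {g : ℝ → ℝ}
    (hg_cont : ContinuousOn g (Ici 0)) (hg_nonneg : ∀ x ∈ Ici (0 : ℝ), 0 ≤ g x)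
    (hg_mono : MonotoneOn g (Ici 0)) (hY : ∀ j, Measurable (Y j)) (hZ : ∀ j, Measurable (Z j))
    (hpos : ∀ᵐ ω ∂P, ∀ j, 0 < Y j ω) (hle : ∀ᵐ ω ∂P, Y 0 ω ≤ B_U) (hQ : 0 ≤ Q) :
    Integrable (queryPenalty g Q Y Z) P := by
  have hgc : Continuous fun x => g (max x 0) :=
    hg_cont.comp_continuous (by fun_prop) fun x => le_max_right x 0
  refine Integrable.of_bound (C := g (Q + B_U)) ?_ ?_
  -- Nothing is known of `g` on negative arguments, so `g (max age 0)` serves as the measurable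
  -- version.
  · refine ⟨_, (hgc.measurable.comp (measurable_age hY hZ hQ)).stronglyMeasurable, ?_⟩
    filter_upwards [hpos] with ω hω
    simp [queryPenalty, max_eq_left (age_mem_Icc hω hQ).1]
  · filter_upwards [hpos, hle] with ω hω hω'
    have h := age_mem_Icc (Z := fun i => Z i ω) hω hQ
    rw [queryPenalty, Real.norm_of_nonneg (hg_nonneg _ h.1)]
    have h2 := h.2.trans (add_le_add_right hω' Q)
    exact hg_mono h.1 (h.1.trans h2) h2

theorem integral_queryPenalty_eq {g : ℝ → ℝ} (hg_nonneg : ∀ x ∈ Ici (0 : ℝ), 0 ≤ g x)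
    (hpos : ∀ᵐ ω ∂P, ∀ j, 0 < Y j ω) (hQ : 0 ≤ Q) (hint : Integrable (queryPenalty g Q Y Z) P) :
    ENNReal.ofReal (∫ ω, queryPenalty g Q Y Z ω ∂P) =
      ∫⁻ ω, ENNReal.ofReal (g (max (age (fun i => Y i ω) (fun i => Z i ω) Q) 0)) ∂P := by
  rw [ofReal_integral_eq_lintegral_ofReal hint]
  · refine lintegral_congr_ae ?_
    filter_upwards [hpos] with ω hω
    simp [queryPenalty, max_eq_left (age_mem_Icc hω hQ).1]
  · filter_upwards [hpos] with ω hω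
    exact hg_nonneg _ (age_mem_Icc hω hQ).1

end Integrability

end PullOrWait

/-! ### The main theorem -/

open PullOrWait in
theorem proposition2 {B_L B_U M : ℝ} (hB_L : 0 < B_L) (hM : 0 ≤ M)
    (μ : Measure ℝ) [IsProbabilityMeasure μ] (hμ : μ (Icc B_L B_U) = 1)
    (g : ℝ → ℝ) (hg_cont : ContinuousOn g (Ici 0)) (hg_nonneg : ∀ x ∈ Ici (0 : ℝ), 0 ≤ g x)
    (hg_mono : MonotoneOn g (Ici 0)) :
    ∃ z : ℝ × ℝ → ℝ, Measurable z ∧ (∀ s, z s ∈ Icc 0 M) ∧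
      ∀ (Ω : Type*) [MeasurableSpace Ω] (P : Measure Ω) [IsProbabilityMeasure P]
        (Y : ℕ → Ω → ℝ), PullOrWait.IsDelayProcess P μ Y →
      ∀ Q : ℝ, 0 < Q →
        ∃ Z : ℕ → Ω → ℝ, PullOrWait.IsStationaryDeterministic z Q Y Z ∧
          PullOrWait.IsOptimal P M g Q Y Z := by
  -- This extends `g` from `[0, ∞)` to a continuous monotone function on `ℝ`, with values where no
  -- integrability is needed.
  set G : ℝ → ENNReal := fun x => ENNReal.ofReal (g (max x 0))
  have hG : Continuous G := ENNReal.continuous_ofReal.comp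
    (hg_cont.comp_continuous (by fun_prop) fun x => le_max_right x 0)
  have hGm : Monotone G := fun x y hxy => ENNReal.ofReal_le_ofReal
    (hg_mono (le_max_right x 0) (le_max_right y 0) (max_le_max_right 0 hxy))
  obtain ⟨z, hzm, hzM, hz⟩ :=
    exists_measurable_actionCost_eq_value (μ := μ) hG hGm hB_L hM
  refine ⟨z, hzm, hzM, fun Ω _ P _ Y hY Q hQ => ⟨stationaryPolicy z Q Y,
    isStationaryDeterministic_stationaryPolicy z Q Y, ?_⟩⟩
  have hmem : ∀ᵐ ω ∂P, ∀ j, Y j ω ∈ Icc B_L B_U := by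
    refine ae_all_iff.2 fun j => ?_
    have h : ∀ᵐ y ∂μ, y ∈ Icc B_L B_U := (prob_compl_eq_zero_iff measurableSet_Icc).2 hμ
    rw [← hY.law j] at h
    exact ae_of_ae_map (hY.measurable j).aemeasurable h
  have hYB : ∀ᵐ ω ∂P, ∀ j, B_L ≤ Y j ω := hmem.mono fun ω h j => (h j).1
  have hpos : ∀ᵐ ω ∂P, ∀ j, 0 < Y j ω := hYB.mono fun ω h j => hB_L.trans_le (h j)
  have hcausal := isCausalPolicy_stationaryPolicy hY hzm hzM Q
  have hint : ∀ Z, IsCausalPolicy P M Y Z → Integrable (queryPenalty g Q Y Z) P := fun Z hZ =>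
    integrable_queryPenalty hg_cont hg_nonneg hg_mono hY.measurable hZ.measurable hpos
      (hmem.mono fun ω h => (h 0).2) hQ.le
  refine ⟨hcausal, hint _ hcausal, fun Z' hZ' => ⟨hint Z' hZ', ?_⟩⟩
  have hnonneg : 0 ≤ ∫ ω, queryPenalty g Q Y Z' ω ∂P := by
    refine integral_nonneg_of_ae ?_
    filter_upwards [hpos] with ω hω
    exact hg_nonneg _ (age_mem_Icc hω hQ.le).1
  rw [← ENNReal.ofReal_le_ofReal_iff hnonneg,
    integral_queryPenalty_eq hg_nonneg hpos hQ.le (hint _ hcausal),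
    integral_queryPenalty_eq hg_nonneg hpos hQ.le (hint _ hZ')]
  exact (lintegral_value_eq hB_L hM hQ.le hG hGm hY.law hYB hcausal hz
    (isStationaryDeterministic_stationaryPolicy z Q Y)).symm.trans_le
      (lintegral_value_le hB_L hM hQ.le hG hGm hY.law hYB hZ')
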